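/- Let $(s(n))_{n\ge 0}$ be Stern's diatomic sequence, defined by $s(0)=0$, $s(1)=1$, $s(2n)=s(n)$ and $s(2n+1)=s(n)+s(n+1)$ for $n\ge 1$. Let $\tau=(1+\sqrt5)/2$ and $$S_0=\begin{pmatrix}1&0\\1&1\end{pmatrix},\qquad S_1=\begin{pmatrix}1&1\\0&1\end{pmatrix}.$$ Among the bounded functions $f=(f_0,f_1)^T:\mathbb{R}\to\mathbb{R}^2$ there is exactly one which satisfies the dilation equation $$f(t)=\tfrac13\bigl(S_0\,f(2t)+S_1\,f(2t-1)\bigr)\qquad(t\in\mathbb{R})$$ together with $f_0(t)=f_1(t)=0$ for all $t\le 0$ and $f_0(t)=f_1(t)=\tfrac12$ for all $t\ge 1$. This solution $f$ is continuous (so it is also the unique continuous solution), and its first coordinate $f_0$ is Hölder continuous on $\mathbb{R}$ with exponent $\log_2(3/\tau)$. Moreover, for every $\varepsilon>0$ there is a constant $C_\varepsilon$ such that, for all real $x\ge 1$, $$\Bigl|\,\sum_{0\le n\le x}s(n)-3^{\lfloor\log_2 x\rfloor+1}\,f_0\bigl(2^{\langle\log_2 x\rangle-1}\bigr)\Bigr|\le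 C_\varepsilon\,x^{\log_2(\tau)+\varepsilon},$$ where $\lfloor y\rfloor$ and $\langle y\rangle=y-\lfloor y\rfloor$ denote the integer and fractional parts of $y$. -/

import Mathlib

open scoped Matrix NNReal

/-- Stern's diatomic sequence: `s 0 = 0`, `s 1 = 1`, `s (2n) = s n` and
`s (2n+1) = s n + s (n+1)`; see `stern_two_mul` and `stern_two_mul_add_one`. -/
def stern : ℕ → ℕ
  | 0 => 0
  | 1 => 1
  | n + 2 =>
    if n % 2 = 0 then stern (n / 2 + 1)
    else stern (n / 2 + 1) + stern (n / 2 + 2)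
termination_by n => n
decreasing_by all_goals omega

theorem stern_zero : stern 0 = 0 := by rw [stern]

theorem stern_one : stern 1 = 1 := by rw [stern]

theorem stern_two_mul (n : ℕ) : stern (2 * n) = stern n := by
  rcases n with _ | n
  · rfl
  · rw [show 2 * (n + 1) = 2 * n + 2 by ring, stern, if_pos (by omega)]
    congr 1
    omega

theorem stern_two_mul_add_one (n : ℕ) :
    stern (2 * n + 1) = stern n + stern (n + 1) := by
  rcases n with _ | n
  · simp [stern_zero, stern_one]
  · rw [show 2 * (n + 1) + 1 = (2 * n + 1) + 2 by ring, stern, if_neg (by omega)]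
    congr 2 <;> omega

/-- The matrix `S₀` of the linear representation of Stern's sequence. -/
def sternS0 : Matrix (Fin 2) (Fin 2) ℝ := !![1, 0; 1, 1]

/-- The matrix `S₁` of the linear representation of Stern's sequence. -/
def sternS1 : Matrix (Fin 2) (Fin 2) ℝ := !![1, 1; 0, 1]

/-- `f = (f₀, f₁)ᵀ` solves the dilation equation
`f(t) = (1/3) (S₀ f(2t) + S₁ f(2t - 1))` on `ℝ`, with `f₀ = f₁ = 0` on `t ≤ 0` and
`f₀ = f₁ = 1/2` on `t ≥ 1`. -/
structure IsSternDilationSolution (f : ℝ → Fin 2 → ℝ) : Prop where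
  dilation : ∀ t : ℝ,
    f t = (1 / 3 : ℝ) • (sternS0 *ᵥ f (2 * t) + sternS1 *ᵥ f (2 * t - 1))
  of_nonpos : ∀ t : ℝ, t ≤ 0 → ∀ i : Fin 2, f t i = 0
  of_one_le : ∀ t : ℝ, 1 ≤ t → ∀ i : Fin 2, f t i = 1 / 2

/-! At every `t` one of `2t - 1 ≤ 0`, `2t ≥ 1` holds, so the boundary conditions fix one of the two
terms of the dilation equation. Only one matrix, of sup-norm at most 2, then acts on the unknown,
and the factor 1/3 gives a contraction: hence existence, continuity and uniqueness.

Iterating along binary digits gives an exact formula (`three_pow_mul_apply_zero`): `3 ^ K * f₀((j +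
t) / 2 ^ K)` is the trapezoidal sum of `s` up to `j` plus `s(j+1) f₀(t) + s(j) f₁(t)`. The
trapezoidal sum differs from the summatory function by `s(j) / 2`, so the error is of the size of
`s(j) + s(j+1)`.

Each digit multiplies `goldenWeight` by at most `τ`. This bounds the error by a multiple of `τ ^ K`;
combined with the factor 1/3, it shows that oscillations at scale `2 ^ (-K)` are `O((τ / 3) ^ K)`,
which is the Hölder exponent. -/

/-- A norm on `ℝ²`, restricted to nonnegative vectors, that is extremal for the pair of maps
`(a, b) ↦ (a + b, b)` and `(a, b) ↦ (a, a + b)`. -/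
noncomputable def goldenWeight (a b : ℝ) : ℝ :=
  max (Real.goldenRatio * a + b) (a + Real.goldenRatio * b)

/-- As `τ² = τ + 1`, both branches on the left are at most `τ (a + τ b)`, the first with equality.
-/
theorem goldenWeight_add_left {a b : ℝ} (ha : 0 ≤ a) :
    goldenWeight (a + b) b ≤ Real.goldenRatio * goldenWeight a b := by
  have h2 := Real.goldenRatio_sq
  have h1 := Real.one_lt_goldenRatio
  have h : a + Real.goldenRatio * b ≤ goldenWeight a b := le_max_right _ _
  refine le_trans ?_ (mul_le_mul_of_nonneg_left h (by linarith))
  refine max_le ?_ ?_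
  · linear_combination -b * h2
  · linear_combination -b * h2 + mul_nonneg ha (sub_nonneg.2 h1.le)

theorem goldenWeight_swap (a b : ℝ) : goldenWeight a b = goldenWeight b a := by
  rw [goldenWeight, goldenWeight, max_comm, add_comm a, add_comm _ b]

theorem goldenWeight_add_right {a b : ℝ} (hb : 0 ≤ b) :
    goldenWeight a (a + b) ≤ Real.goldenRatio * goldenWeight a b := by
  rw [goldenWeight_swap, goldenWeight_swap a b, add_comm a b]
  exact goldenWeight_add_left hb

theorem add_le_goldenWeight {a b : ℝ} (ha : 0 ≤ a) : a + b ≤ goldenWeight a b := by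
  refine le_trans ?_ (le_max_left _ _)
  nlinarith [Real.one_lt_goldenRatio]

theorem goldenWeight_nonneg {a b : ℝ} (ha : 0 ≤ a) (hb : 0 ≤ b) : 0 ≤ goldenWeight a b :=
  (add_nonneg ha hb).trans (add_le_goldenWeight ha)

/-- Appending a binary digit to the index applies one of the two maps to `(s(j+1), s(j))`; the start
`(1, 0)` has weight `τ`. -/
theorem goldenWeight_stern_le (K : ℕ) : ∀ j < 2 ^ K,
    goldenWeight (stern (j + 1)) (stern j) ≤ Real.goldenRatio ^ (K + 1) := by
  induction K with
  | zero =>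
    intro j hj
    obtain rfl : j = 0 := by simpa using hj
    simp [stern_zero, stern_one, goldenWeight, Real.one_lt_goldenRatio.le]
  | succ K ih =>
    intro j hj
    have h0 := Real.goldenRatio_pos.le
    rw [pow_succ' _ (K + 1)]
    obtain ⟨m, rfl | rfl⟩ := Nat.even_or_odd' j
    · refine le_trans ?_ (mul_le_mul_of_nonneg_left (ih m (by omega)) h0)
      rw [stern_two_mul, stern_two_mul_add_one, Nat.cast_add, add_comm (stern m : ℝ)]
      exact goldenWeight_add_left (Nat.cast_nonneg _)
    · refine le_trans ?_ (mul_le_mul_of_nonneg_left (ih m (by omega)) h0)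
      rw [show 2 * m + 1 + 1 = 2 * (m + 1) by ring, stern_two_mul, stern_two_mul_add_one,
        Nat.cast_add, add_comm (stern m : ℝ)]
      exact goldenWeight_add_right (Nat.cast_nonneg _)

/-! ### Trapezoidal sums -/

/-- The trapezoidal sums of Stern's sequence. -/
noncomputable def sternTrapezoid (j : ℕ) : ℝ :=
  ∑ n ∈ Finset.range j, ((stern n : ℝ) + stern (n + 1)) / 2

theorem sternTrapezoid_succ (j : ℕ) :
    sternTrapezoid (j + 1) = sternTrapezoid j + ((stern j : ℝ) + stern (j + 1)) / 2 :=
  Finset.sum_range_succ _ _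

theorem sternTrapezoid_two_mul_add_one (j : ℕ) :
    sternTrapezoid (2 * j + 1) =
      sternTrapezoid (2 * j) + (2 * (stern j : ℝ) + stern (j + 1)) / 2 := by
  rw [sternTrapezoid_succ, stern_two_mul, stern_two_mul_add_one]
  push_cast
  ring

/-- Halving the end terms makes the scaling exact, because `s(2n) + 2 s(2n+1) + s(2n+2) = 3 (s(n) +
s(n+1))`. -/
theorem sternTrapezoid_two_mul (j : ℕ) : sternTrapezoid (2 * j) = 3 * sternTrapezoid j := by
  induction j with
  | zero => simp [sternTrapezoid]
  | succ j ih =>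
    rw [show 2 * (j + 1) = 2 * j + 1 + 1 by ring, sternTrapezoid_succ (2 * j + 1),
      sternTrapezoid_two_mul_add_one, ih, show 2 * j + 1 + 1 = 2 * (j + 1) by ring,
      stern_two_mul, stern_two_mul_add_one, sternTrapezoid_succ]
    push_cast
    ring

theorem sum_stern_eq_sternTrapezoid (j : ℕ) :
    ∑ n ∈ Finset.range (j + 1), (stern n : ℝ) = sternTrapezoid j + stern j / 2 := by
  induction j with
  | zero => simp [sternTrapezoid, stern_zero]
  | succ j ih =>
    rw [Finset.sum_range_succ, ih, sternTrapezoid_succ]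
    ring

/-! ### The dilation equation along binary digits -/

namespace IsSternDilationSolution

variable {f : ℝ → Fin 2 → ℝ}

theorem apply_zero (hf : IsSternDilationSolution f) (t : ℝ) :
    f t 0 = (f (2 * t) 0 + (f (2 * t - 1) 0 + f (2 * t - 1) 1)) / 3 := by
  rw [hf.dilation t]
  simp [sternS0, sternS1, dotProduct, Fin.sum_univ_two]
  ring

theorem apply_one (hf : IsSternDilationSolution f) (t : ℝ) :
    f t 1 = (f (2 * t) 0 + f (2 * t) 1 + f (2 * t - 1) 1) / 3 := by
  rw [hf.dilation t]
  simp [sternS0, sternS1, dotProduct, Fin.sum_univ_two]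
  ring

/-- Here `f(2t - 1) = 0`. Linear combinations are tracked because dilation moves the coefficients by
the same two maps that drive Stern's sequence. -/
theorem combination_of_le_half (hf : IsSternDilationSolution f) (a b : ℝ) {t : ℝ}
    (ht : t ≤ 1 / 2) :
    a * f t 0 + b * f t 1 = ((a + b) * f (2 * t) 0 + b * f (2 * t) 1) / 3 := by
  rw [hf.apply_zero t, hf.apply_one t, hf.of_nonpos (2 * t - 1) (by linarith),
    hf.of_nonpos (2 * t - 1) (by linarith)]
  ring

theorem combination_of_half_le (hf : IsSternDilationSolution f) (a b : ℝ) {t : ℝ}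
    (ht : 1 / 2 ≤ t) :
    a * f t 0 + b * f t 1 =
      (a / 2 + b + (a * f (2 * t - 1) 0 + (a + b) * f (2 * t - 1) 1)) / 3 := by
  rw [hf.apply_zero t, hf.apply_one t, hf.of_one_le (2 * t) (by linarith),
    hf.of_one_le (2 * t) (by linarith)]
  ring

/-- The refinement of the dilation equation on the dyadic interval `[j / 2 ^ K, (j + 1) / 2 ^ K]`. -/
theorem three_pow_mul_apply_zero (hf : IsSternDilationSolution f) (K : ℕ) :
    ∀ j : ℕ, j < 2 ^ K → ∀ t : ℝ, 0 ≤ t → t ≤ 1 →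
      3 ^ K * f ((j + t) / 2 ^ K) 0 =
        sternTrapezoid j + (stern (j + 1) * f t 0 + stern j * f t 1) := by
  induction K with
  | zero =>
    intro j hj t _ _
    obtain rfl : j = 0 := by simpa using hj
    simp [sternTrapezoid, stern_zero, stern_one]
  | succ K ih =>
    intro j hj t h0 h1
    obtain ⟨m, rfl | rfl⟩ := Nat.even_or_odd' j
    -- The interval of `2m` is the left half of that of `m`, and the interval of `2m + 1` the right
    -- half.
    · have h := ih m (by omega) (t / 2) (by linarith) (by linarith)
      rw [hf.combination_of_le_half _ _ (by linarith), mul_div_cancel₀ t two_ne_zero] at h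
      rw [show ((2 * m : ℕ) + t : ℝ) / 2 ^ (K + 1) = (m + t / 2) / 2 ^ K by
        push_cast; field_simp; ring, pow_succ', mul_assoc, h, sternTrapezoid_two_mul,
        stern_two_mul, stern_two_mul_add_one]
      push_cast
      ring
    · have h := ih m (by omega) ((t + 1) / 2) (by linarith) (by linarith)
      rw [hf.combination_of_half_le _ _ (by linarith), mul_div_cancel₀ (t + 1) two_ne_zero,
        add_sub_cancel_right] at h
      rw [show ((2 * m + 1 : ℕ) + t : ℝ) / 2 ^ (K + 1) = (m + (t + 1) / 2) / 2 ^ K by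
        push_cast; field_simp; ring, pow_succ', mul_assoc, h, sternTrapezoid_two_mul_add_one,
        sternTrapezoid_two_mul, show 2 * m + 1 + 1 = 2 * (m + 1) by ring,
        stern_two_mul, stern_two_mul_add_one]
      push_cast
      ring

/-! ### Oscillation at dyadic scales -/

section Oscillation

variable {M : ℝ}

theorem abs_combination_sub_le (hM : ∀ t i, |f t i| ≤ M) {a b : ℝ} (ha : 0 ≤ a) (hb : 0 ≤ b)
    (s t : ℝ) :
    |(a * f s 0 + b * f s 1) - (a * f t 0 + b * f t 1)| ≤ 2 * M * goldenWeight a b := by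
  have hM0 : 0 ≤ M := (abs_nonneg _).trans (hM 0 0)
  have h (i : Fin 2) : |f s i - f t i| ≤ 2 * M := by
    have := abs_sub (f s i) (f t i)
    linarith [hM s i, hM t i]
  calc |(a * f s 0 + b * f s 1) - (a * f t 0 + b * f t 1)|
      = |a * (f s 0 - f t 0) + b * (f s 1 - f t 1)| := by congr 1; ring
    _ ≤ a * |f s 0 - f t 0| + b * |f s 1 - f t 1| := by
        refine (abs_add_le _ _).trans_eq ?_
        rw [abs_mul, abs_mul, abs_of_nonneg ha, abs_of_nonneg hb]
    _ ≤ a * (2 * M) + b * (2 * M) := by gcongr <;> exact h _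
    _ = 2 * M * (a + b) := by ring
    _ ≤ 2 * M * goldenWeight a b := by gcongr; exact add_le_goldenWeight ha

/-- The inductive step shared by the estimates below: dilation gains 1/3 and costs at most `τ` in
weight. -/
theorem div_three_le {x C w v : ℝ} (K : ℕ) (hC : 0 ≤ C)
    (hx : |x| ≤ C * v * (Real.goldenRatio / 3) ^ K) (hv : v ≤ Real.goldenRatio * w) :
    |x / 3| ≤ C * w * (Real.goldenRatio / 3) ^ (K + 1) := by
  have h0 : 0 ≤ Real.goldenRatio / 3 := by have := Real.goldenRatio_pos; positivity
  rw [abs_div, abs_of_pos (three_pos : (0 : ℝ) < 3), div_le_iff₀ three_pos]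
  calc |x| ≤ C * v * (Real.goldenRatio / 3) ^ K := hx
    _ ≤ C * (Real.goldenRatio * w) * (Real.goldenRatio / 3) ^ K := by gcongr
    _ = _ := by ring

theorem abs_combination_le_near_zero (hf : IsSternDilationSolution f)
    (hM : ∀ t i, |f t i| ≤ M) (K : ℕ) : ∀ a b : ℝ, 0 ≤ a → 0 ≤ b → ∀ t ≤ (1 / 2 : ℝ) ^ K,
      |a * f t 0 + b * f t 1| ≤ 2 * M * goldenWeight a b * (Real.goldenRatio / 3) ^ K := by
  have hM0 : 0 ≤ M := (abs_nonneg _).trans (hM 0 0)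
  induction K with
  | zero =>
    intro a b ha hb t _
    simpa [hf.of_nonpos 0 le_rfl] using abs_combination_sub_le hM ha hb t 0
  | succ K ih =>
    intro a b ha hb t ht
    have hK : (1 / 2 : ℝ) ^ K ≤ 1 := pow_le_one₀ (by norm_num) (by norm_num)
    rw [pow_succ] at ht
    rw [hf.combination_of_le_half _ _ (by linarith)]
    exact div_three_le K (by positivity)
      (ih (a + b) b (by positivity) hb _ (by linarith)) (goldenWeight_add_left ha)

theorem abs_combination_sub_le_near_one (hf : IsSternDilationSolution f)
    (hM : ∀ t i, |f t i| ≤ M) (K : ℕ) : ∀ a b : ℝ, 0 ≤ a → 0 ≤ b → ∀ t, 1 - (1 / 2 : ℝ) ^ K ≤ t →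
      |(a * f t 0 + b * f t 1) - (a + b) / 2| ≤
        2 * M * goldenWeight a b * (Real.goldenRatio / 3) ^ K := by
  have hM0 : 0 ≤ M := (abs_nonneg _).trans (hM 0 0)
  induction K with
  | zero =>
    intro a b ha hb t _
    have h := abs_combination_sub_le hM ha hb t 1
    rw [hf.of_one_le 1 le_rfl, hf.of_one_le 1 le_rfl] at h
    rw [pow_zero, mul_one]
    convert h using 2
    ring
  | succ K ih =>
    intro a b ha hb t ht
    have hK : (1 / 2 : ℝ) ^ K ≤ 1 := pow_le_one₀ (by norm_num) (by norm_num)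
    rw [pow_succ] at ht
    rw [hf.combination_of_half_le _ _ (by linarith)]
    have h := div_three_le K (by positivity)
      (ih a (a + b) ha (by positivity) (2 * t - 1) (by linarith)) (goldenWeight_add_right hb)
    convert h using 2
    ring

theorem abs_combination_sub_le_of_le (hf : IsSternDilationSolution f)
    (hM : ∀ t i, |f t i| ≤ M) (K : ℕ) :
    ∀ a b : ℝ, 0 ≤ a → 0 ≤ b → ∀ s t, s ≤ t → t - s ≤ (1 / 2 : ℝ) ^ K →
      |(a * f t 0 + b * f t 1) - (a * f s 0 + b * f s 1)| ≤
        4 * M * goldenWeight a b * (Real.goldenRatio / 3) ^ K := by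
  have hM0 : 0 ≤ M := (abs_nonneg _).trans (hM 0 0)
  induction K with
  | zero =>
    intro a b ha hb s t _ _
    have h := abs_combination_sub_le hM ha hb t s
    have := mul_nonneg hM0 (goldenWeight_nonneg ha hb)
    rw [pow_zero, mul_one]
    linarith
  | succ K ih =>
    intro a b ha hb s t hst ht
    rw [pow_succ] at ht
    rcases le_total t (1 / 2) with h1 | h1
    · rw [hf.combination_of_le_half _ _ h1, hf.combination_of_le_half _ _ (hst.trans h1)]
      have h := div_three_le K (by positivity)
        (ih (a + b) b (by positivity) hb (2 * s) (2 * t) (by linarith) (by linarith))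
        (goldenWeight_add_left ha)
      convert h using 2
      ring
    rcases le_total (1 / 2) s with h2 | h2
    · rw [hf.combination_of_half_le _ _ h1, hf.combination_of_half_le _ _ h2]
      have h := div_three_le K (by positivity)
        (ih a (a + b) ha (by positivity) (2 * s - 1) (2 * t - 1) (by linarith) (by linarith))
        (goldenWeight_add_right hb)
      convert h using 2
      ring
    -- When `s ≤ 1/2 ≤ t`, both values are compared with the value at `1/2`: `2t - 1` is close to 0
    -- and `2s` close to 1. The two errors of `2 * M` account for the `4 * M`.
    · rw [hf.combination_of_half_le _ _ h1, hf.combination_of_le_half _ _ h2]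
      have hr := div_three_le K (by positivity)
        (hf.abs_combination_le_near_zero hM K a (a + b) ha (by positivity) (2 * t - 1)
          (by linarith)) (goldenWeight_add_right hb)
      have hl := div_three_le K (by positivity)
        (hf.abs_combination_sub_le_near_one hM K (a + b) b (by positivity) hb (2 * s)
          (by linarith)) (goldenWeight_add_left ha)
      rw [abs_le] at hr hl ⊢
      constructor <;> linarith [hr.1, hr.2, hl.1, hl.2]

theorem abs_apply_zero_sub_le (hf : IsSternDilationSolution f) (hM : ∀ t i, |f t i| ≤ M) (K : ℕ)
    {s t : ℝ} (hst : |t - s| ≤ (1 / 2 : ℝ) ^ K) :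
    |f t 0 - f s 0| ≤ 4 * M * Real.goldenRatio * (Real.goldenRatio / 3) ^ K := by
  have hw : goldenWeight 1 0 = Real.goldenRatio := by
    simp [goldenWeight, Real.one_lt_goldenRatio.le]
  rcases le_total s t with h | h
  · rw [abs_of_nonneg (sub_nonneg.2 h)] at hst
    simpa [hw] using hf.abs_combination_sub_le_of_le hM K 1 0 zero_le_one le_rfl s t h hst
  · rw [abs_sub_comm, abs_of_nonneg (sub_nonneg.2 h)] at hst
    rw [abs_sub_comm]
    simpa [hw] using hf.abs_combination_sub_le_of_le hM K 1 0 zero_le_one le_rfl t s h hst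

end Oscillation

/-! ### Hölder continuity and the summatory function -/

theorem exists_holderWith_apply_zero (hf : IsSternDilationSolution f) {M : ℝ}
    (hM : ∀ t i, |f t i| ≤ M) :
    ∃ C r : ℝ≥0, (r : ℝ) = Real.logb 2 (3 / Real.goldenRatio) ∧
      HolderWith C r (fun t : ℝ => f t 0) := by
  have hM0 : 0 ≤ M := (abs_nonneg _).trans (hM 0 0)
  have hφ := Real.goldenRatio_pos
  have hφ2 := Real.goldenRatio_lt_two
  set q : ℝ := 3 / Real.goldenRatio with hq
  have hq1 : 1 < q := by rw [hq, lt_div_iff₀ hφ]; linarith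
  have hr : 0 < Real.logb 2 q := Real.logb_pos one_lt_two hq1
  have h2r : (2 : ℝ) ^ Real.logb 2 q = q :=
    Real.rpow_logb two_pos (by norm_num) (by linarith)
  have hhalf : (1 / 2 : ℝ) ^ Real.logb 2 q = Real.goldenRatio / 3 := by
    rw [Real.div_rpow zero_le_one two_pos.le, h2r, Real.one_rpow, hq, one_div_div]
  have hC : 0 ≤ 4 * M * Real.goldenRatio * q := by positivity
  refine ⟨(4 * M * Real.goldenRatio * q).toNNReal, (Real.logb 2 q).toNNReal,
    Real.coe_toNNReal _ hr.le, fun s t => ?_⟩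
  have key : dist (f s 0) (f t 0) ≤
      4 * M * Real.goldenRatio * q * dist s t ^ Real.logb 2 q := by
    rcases eq_or_ne s t with rfl | hne
    · rw [dist_self, dist_self, Real.zero_rpow hr.ne', mul_zero]
    have hd : 0 < |s - t| := abs_pos.2 (sub_ne_zero.2 hne)
    rw [Real.dist_eq, Real.dist_eq]
    rcases le_total 1 |s - t| with h1 | h1
    · have h := abs_combination_sub_le hM zero_le_one le_rfl s t
      have hw : goldenWeight 1 0 = Real.goldenRatio := by
        simp [goldenWeight, Real.one_lt_goldenRatio.le]
      rw [hw] at h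
      have h3 : 1 ≤ |s - t| ^ Real.logb 2 q := Real.one_le_rpow h1 hr.le
      have h4 : 1 ≤ q * |s - t| ^ Real.logb 2 q := one_le_mul_of_one_le_of_one_le hq1.le h3
      calc |f s 0 - f t 0| ≤ 2 * M * Real.goldenRatio := by simpa using h
        _ ≤ 4 * M * Real.goldenRatio * 1 := by nlinarith [mul_nonneg hM0 hφ.le]
        _ ≤ 4 * M * Real.goldenRatio * (q * |s - t| ^ Real.logb 2 q) := by gcongr
        _ = _ := by ring
    -- The distance lies between `(1/2) ^ (K + 1)` and `(1/2) ^ K`; the factor `q` in the constant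
    -- pays for this gap.
    · obtain ⟨K, hK1, hK2⟩ := exists_nat_pow_near_of_lt_one hd h1 (y := (1 / 2 : ℝ))
        (by norm_num) (by norm_num)
      refine (hf.abs_apply_zero_sub_le hM K hK2).trans ?_
      rw [mul_assoc (4 * M * Real.goldenRatio)]
      gcongr
      calc (Real.goldenRatio / 3) ^ K = q * (Real.goldenRatio / 3) ^ (K + 1) := by
            have : q * (Real.goldenRatio / 3) = 1 := by
              rw [hq, div_mul_div_cancel₀ hφ.ne', div_self three_ne_zero]
            rw [pow_succ', ← mul_assoc, this, one_mul]
        _ = q * ((1 / 2 : ℝ) ^ (K + 1)) ^ Real.logb 2 q := by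
            rw [← hhalf, ← Real.rpow_natCast, ← Real.rpow_natCast, ← Real.rpow_mul (by norm_num),
              ← Real.rpow_mul (by norm_num), mul_comm (Real.logb 2 q)]
        _ ≤ q * |s - t| ^ Real.logb 2 q := by gcongr
  rw [Real.coe_toNNReal _ hr.le, edist_dist, edist_dist,
    ENNReal.ofReal_rpow_of_nonneg dist_nonneg hr.le, ← ENNReal.ofReal, ← ENNReal.ofReal_mul hC]
  exact ENNReal.ofReal_le_ofReal key

theorem exists_abs_sum_stern_sub_le (hf : IsSternDilationSolution f) {M : ℝ}
    (hM : ∀ t i, |f t i| ≤ M) {ε : ℝ} (hε : 0 < ε) :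
    ∃ C : ℝ, ∀ x : ℝ, 1 ≤ x →
      |(∑ n ∈ Finset.range (⌊x⌋₊ + 1), (stern n : ℝ)) -
          (3 : ℝ) ^ (⌊Real.logb 2 x⌋ + 1) *
            f ((2 : ℝ) ^ (Int.fract (Real.logb 2 x) - 1)) 0|
        ≤ C * x ^ (Real.logb 2 Real.goldenRatio + ε) := by
  have hM0 : 0 ≤ M := (abs_nonneg _).trans (hM 0 0)
  have hφ := Real.goldenRatio_pos
  have hφ1 := Real.one_lt_goldenRatio
  -- `1/2` comes from the trapezoidal correction, `M` from the values of `f`, and `τ²` from the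
  -- weight bound `τ ^ (k + 2)` at level `k + 1`.
  refine ⟨(1 / 2 + M) * Real.goldenRatio ^ 2, fun x hx => ?_⟩
  have hx0 : 0 < x := by linarith
  have hl0 : 0 ≤ Real.logb 2 x := Real.logb_nonneg one_lt_two hx
  obtain ⟨k, hk⟩ : ∃ k : ℕ, ⌊Real.logb 2 x⌋ = k := Int.eq_ofNat_of_zero_le (Int.floor_nonneg.2 hl0)
  have hkle : (k : ℝ) ≤ Real.logb 2 x := by
    have := Int.floor_le (Real.logb 2 x)
    rwa [hk] at this
  have hklt : Real.logb 2 x < (k + 1 : ℕ) := by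
    have := Int.lt_floor_add_one (Real.logb 2 x)
    rw [hk] at this
    exact_mod_cast this
  have hpow : (2 : ℝ) ^ Real.logb 2 x = x := Real.rpow_logb two_pos (by norm_num) hx0
  have hxlt : x < 2 ^ (k + 1) := by
    rw [← Real.rpow_natCast, ← hpow]
    exact Real.rpow_lt_rpow_of_exponent_lt one_lt_two hklt
  have hj : ⌊x⌋₊ < 2 ^ (k + 1) := by
    rw [Nat.floor_lt hx0.le]
    exact_mod_cast hxlt
  have harg : (2 : ℝ) ^ (Int.fract (Real.logb 2 x) - 1) = x / 2 ^ (k + 1) := by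
    have : Int.fract (Real.logb 2 x) - 1 = Real.logb 2 x - (k + 1 : ℕ) := by
      rw [Int.fract, hk]
      push_cast
      ring
    rw [this, Real.rpow_sub two_pos, hpow, Real.rpow_natCast]
  have hz : (3 : ℝ) ^ (⌊Real.logb 2 x⌋ + 1) = 3 ^ (k + 1) := by
    rw [hk]
    exact_mod_cast zpow_natCast (3 : ℝ) (k + 1)
  have hfl := Nat.floor_le hx0.le
  have hfl2 := (Nat.lt_floor_add_one x).le
  -- Level `k + 1` is the one with `x / 2 ^ (k + 1)` in `[1/2, 1)`; `t` is the fractional part of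
  -- `x`.
  have hid := hf.three_pow_mul_apply_zero (k + 1) _ hj (x - ⌊x⌋₊) (by linarith) (by linarith)
  rw [add_sub_cancel] at hid
  rw [hz, harg, hid, sum_stern_eq_sternTrapezoid]
  set j := ⌊x⌋₊
  have hgrow := (add_le_goldenWeight (Nat.cast_nonneg _)).trans (goldenWeight_stern_le (k + 1) j hj)
  have h0 := abs_le.1 (hM (x - j) 0)
  have h1 := abs_le.1 (hM (x - j) 1)
  have hs0 : (0 : ℝ) ≤ stern j := Nat.cast_nonneg _
  have hs1 : (0 : ℝ) ≤ stern (j + 1) := Nat.cast_nonneg _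
  have hpk : Real.goldenRatio ^ k ≤ x ^ (Real.logb 2 Real.goldenRatio + ε) := by
    calc Real.goldenRatio ^ k = ((2 : ℝ) ^ (k : ℝ)) ^ Real.logb 2 Real.goldenRatio := by
          rw [← Real.rpow_mul two_pos.le, mul_comm, Real.rpow_mul two_pos.le,
            Real.rpow_logb two_pos (by norm_num) hφ, Real.rpow_natCast]
      _ ≤ x ^ Real.logb 2 Real.goldenRatio := by
          refine Real.rpow_le_rpow (by positivity) ?_ (Real.logb_nonneg one_lt_two hφ1.le)
          calc (2 : ℝ) ^ (k : ℝ) ≤ 2 ^ Real.logb 2 x :=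
                Real.rpow_le_rpow_of_exponent_le one_le_two hkle
            _ = x := hpow
      _ ≤ _ := Real.rpow_le_rpow_of_exponent_le hx (by linarith)
  calc _ ≤ (1 / 2 + M) * ((stern (j + 1) : ℝ) + stern j) := by
        rw [abs_le]
        constructor <;>
        nlinarith [mul_le_mul_of_nonneg_left h0.1 hs1, mul_le_mul_of_nonneg_left h0.2 hs1,
          mul_le_mul_of_nonneg_left h1.1 hs0, mul_le_mul_of_nonneg_left h1.2 hs0]
    _ ≤ (1 / 2 + M) * Real.goldenRatio ^ (k + 1 + 1) := by gcongr
    _ = (1 / 2 + M) * Real.goldenRatio ^ 2 * Real.goldenRatio ^ k := by ring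
    _ ≤ _ := by gcongr

theorem exists_abs_le (hb : Bornology.IsBounded (Set.range f)) : ∃ M, ∀ t i, |f t i| ≤ M := by
  obtain ⟨M, hM⟩ := hb.exists_norm_le
  exact ⟨M, fun t i => (norm_le_pi_norm (f t) i).trans (hM _ ⟨t, rfl⟩)⟩

end IsSternDilationSolution

/-! ### Existence and uniqueness by contraction -/

theorem norm_sternS0_mulVec_le (v : Fin 2 → ℝ) : ‖sternS0 *ᵥ v‖ ≤ 2 * ‖v‖ := by
  have h0 : |v 0| ≤ ‖v‖ := norm_le_pi_norm v 0
  have h1 : |v 1| ≤ ‖v‖ := norm_le_pi_norm v 1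
  refine (pi_norm_le_iff_of_nonneg (by positivity)).2 fun i => ?_
  have h2 := abs_add_le (v 0) (v 1)
  fin_cases i <;> simp [sternS0, dotProduct, Fin.sum_univ_two] <;>
    linarith [norm_nonneg v]

theorem norm_sternS1_mulVec_le (v : Fin 2 → ℝ) : ‖sternS1 *ᵥ v‖ ≤ 2 * ‖v‖ := by
  have h0 : |v 0| ≤ ‖v‖ := norm_le_pi_norm v 0
  have h1 : |v 1| ≤ ‖v‖ := norm_le_pi_norm v 1
  refine (pi_norm_le_iff_of_nonneg (by positivity)).2 fun i => ?_
  have h2 := abs_add_le (v 0) (v 1)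
  fin_cases i <;> simp [sternS1, dotProduct, Fin.sum_univ_two] <;>
    linarith [norm_nonneg v]

/-- The boundary conditions of the dilation equation. -/
def SternBoundary (f : ℝ → Fin 2 → ℝ) : Prop :=
  (∀ t ≤ 0, f t = 0) ∧ ∀ t, 1 ≤ t → f t = fun _ => 1 / 2

/-- The right-hand side of the dilation equation. -/
noncomputable def sternDilation (f : ℝ → Fin 2 → ℝ) (t : ℝ) : Fin 2 → ℝ :=
  (1 / 3 : ℝ) • (sternS0 *ᵥ f (2 * t) + sternS1 *ᵥ f (2 * t - 1))

theorem IsSternDilationSolution.sternBoundary {f : ℝ → Fin 2 → ℝ}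
    (hf : IsSternDilationSolution f) : SternBoundary f :=
  ⟨fun t ht => funext (hf.of_nonpos t ht), fun t ht => funext (hf.of_one_le t ht)⟩

theorem SternBoundary.sternDilation {f : ℝ → Fin 2 → ℝ} (hf : SternBoundary f) :
    SternBoundary (sternDilation f) := by
  refine ⟨fun t ht => ?_, fun t ht => ?_⟩
  · rw [_root_.sternDilation, hf.1 _ (by linarith), hf.1 _ (by linarith)]
    simp
  · rw [_root_.sternDilation, hf.2 _ (by linarith), hf.2 _ (by linarith)]
    ext i
    fin_cases i <;>
      simp [sternS0, sternS1, dotProduct, Fin.sum_univ_two] <;> norm_num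

/-- At each `t` the boundary conditions make one term agree for `f` and `g`; otherwise the norm
bounds would only give `4/3`. -/
theorem dist_sternDilation_le {f g : ℝ → Fin 2 → ℝ} (hf : SternBoundary f)
    (hg : SternBoundary g) {D : ℝ} (hD : ∀ t, dist (f t) (g t) ≤ D) (t : ℝ) :
    dist (sternDilation f t) (sternDilation g t) ≤ 2 / 3 * D := by
  rw [sternDilation, sternDilation, dist_smul₀, Real.norm_of_nonneg (by norm_num)]
  rcases le_total t (1 / 2) with h | h
  · rw [hf.1 (2 * t - 1) (by linarith), hg.1 (2 * t - 1) (by linarith), dist_add_right,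
      dist_eq_norm, ← Matrix.mulVec_sub]
    have h1 := norm_sternS0_mulVec_le (f (2 * t) - g (2 * t))
    have h2 := hD (2 * t)
    rw [dist_eq_norm] at h2
    linarith
  · rw [hf.2 (2 * t) (by linarith), hg.2 (2 * t) (by linarith), dist_add_left,
      dist_eq_norm, ← Matrix.mulVec_sub]
    have h1 := norm_sternS1_mulVec_le (f (2 * t - 1) - g (2 * t - 1))
    have h2 := hD (2 * t - 1)
    rw [dist_eq_norm] at h2
    linarith

theorem IsSternDilationSolution.eq_of_isBounded {f g : ℝ → Fin 2 → ℝ}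
    (hf : IsSternDilationSolution f) (hg : IsSternDilationSolution g)
    (hfb : Bornology.IsBounded (Set.range f)) (hgb : Bornology.IsBounded (Set.range g)) :
    f = g := by
  obtain ⟨A, hA⟩ := hfb.exists_norm_le
  obtain ⟨B, hB⟩ := hgb.exists_norm_le
  have hbd : BddAbove (Set.range fun t => dist (f t) (g t)) := by
    refine ⟨A + B, ?_⟩
    rintro _ ⟨t, rfl⟩
    exact (dist_le_norm_add_norm _ _).trans (add_le_add (hA _ ⟨t, rfl⟩) (hB _ ⟨t, rfl⟩))
  have hle (t : ℝ) : dist (f t) (g t) ≤ ⨆ t, dist (f t) (g t) := le_ciSup hbd t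
  have hsup : ⨆ t, dist (f t) (g t) ≤ 2 / 3 * ⨆ t, dist (f t) (g t) := ciSup_le fun t => by
    have h := dist_sternDilation_le hf.sternBoundary hg.sternBoundary hle t
    rwa [sternDilation, sternDilation, ← hf.dilation, ← hg.dilation] at h
  ext1 t
  exact dist_le_zero.1 ((hle t).trans (by linarith))

-- Banach's fixed point theorem, applied on the closed set of bounded continuous functions with the
-- prescribed boundary values, where dilation contracts by `2/3`.
open scoped BoundedContinuousFunction in
theorem exists_continuous_isSternDilationSolution : ∃ f : ℝ → Fin 2 → ℝ,
    IsSternDilationSolution f ∧ Continuous f ∧ Bornology.IsBounded (Set.range f) := by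
  have hcont (f : ℝ →ᵇ (Fin 2 → ℝ)) : Continuous (sternDilation f) := by
    unfold sternDilation
    have := f.continuous
    fun_prop
  have hbound (f : ℝ →ᵇ (Fin 2 → ℝ)) (t : ℝ) : ‖sternDilation f t‖ ≤ 4 / 3 * ‖f‖ := by
    rw [sternDilation, norm_smul, Real.norm_of_nonneg (by norm_num)]
    have h0 := (norm_sternS0_mulVec_le (f (2 * t))).trans
      (mul_le_mul_of_nonneg_left (f.norm_coe_le_norm _) two_pos.le)
    have h1 := (norm_sternS1_mulVec_le (f (2 * t - 1))).trans
      (mul_le_mul_of_nonneg_left (f.norm_coe_le_norm _) two_pos.le)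
    linarith [norm_add_le (sternS0 *ᵥ f (2 * t)) (sternS1 *ᵥ f (2 * t - 1))]
  let T (f : ℝ →ᵇ (Fin 2 → ℝ)) : ℝ →ᵇ (Fin 2 → ℝ) :=
    BoundedContinuousFunction.ofNormedAddCommGroup _ (hcont f) _ (hbound f)
  let S : Set (ℝ →ᵇ (Fin 2 → ℝ)) := {f | SternBoundary f}
  have hS : IsClosed S := by
    have hS' : S = (⋂ t ≤ (0 : ℝ), {f | f t = 0}) ∩
        ⋂ t, ⋂ (_ : (1 : ℝ) ≤ t), {f | f t = fun _ => 1 / 2} := by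
      ext f
      simp [S, SternBoundary]
    rw [hS']
    refine (isClosed_biInter fun t _ => ?_).inter 
      (isClosed_iInter fun t => isClosed_iInter fun _ => ?_)
    · exact isClosed_eq (BoundedContinuousFunction.lipschitz_eval_const t).continuous continuous_const
    · exact isClosed_eq (BoundedContinuousFunction.lipschitz_eval_const t).continuous continuous_const
  have hT : Set.MapsTo T S S := fun f hf => SternBoundary.sternDilation hf
  have hcontr : ContractingWith (2 / 3) (hT.restrict T S S) := by
    refine ⟨?_, LipschitzWith.of_dist_le_mul fun f g => ?_⟩
    · rw [← NNReal.coe_lt_coe]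
      norm_num
    · change dist (T f) (T g) ≤ _ * dist (f : ℝ →ᵇ (Fin 2 → ℝ)) g
      refine (BoundedContinuousFunction.dist_le (by positivity)).2 fun t => ?_
      exact dist_sternDilation_le f.2 g.2
        (fun s => BoundedContinuousFunction.dist_coe_le_dist s) t
  -- A continuous ramp from 0 to `1/2` shows that the boundary conditions can be met.
  let f₀ : ℝ →ᵇ (Fin 2 → ℝ) := BoundedContinuousFunction.ofNormedAddCommGroup
    (fun t _ => max 0 (min t 1) / 2) (by fun_prop) 1 (fun t => by
      refine (pi_norm_le_iff_of_nonneg zero_le_one).2 fun _ => ?_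
      rw [Real.norm_of_nonneg (by positivity)]
      have : max 0 (min t 1) ≤ 1 := max_le zero_le_one (min_le_right _ _)
      linarith)
  have hf₀ : f₀ ∈ S := by
    refine ⟨fun t ht => ?_, fun t ht => ?_⟩
    · ext i
      simp [f₀, ht]
    · ext i
      simp [f₀, ht]
  obtain ⟨f, hfS, hfix, -⟩ := hcontr.exists_fixedPoint' hS.isComplete hT hf₀ (edist_ne_top _ _)
  refine ⟨f, ⟨fun t => ?_, fun t ht i => ?_, fun t ht i => ?_⟩, f.continuous, f.isBounded_range⟩
  · exact (DFunLike.congr_fun hfix t).symm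
  · rw [hfS.1 t ht, Pi.zero_apply]
  · rw [hfS.2 t ht]

theorem proposition2 :
    ∃ f : ℝ → Fin 2 → ℝ,
      -- `f` is a continuous, bounded solution of the dilation equation,
      (IsSternDilationSolution f ∧ Continuous f ∧ Bornology.IsBounded (Set.range f)) ∧
      -- it is the only bounded solution (in particular, the only continuous one),
      (∀ g : ℝ → Fin 2 → ℝ, IsSternDilationSolution g →
        Bornology.IsBounded (Set.range g) → g = f) ∧
      -- `f₀` is Hölder continuous with exponent `log₂ (3 / τ)`,
      (∃ C r : ℝ≥0, (r : ℝ) = Real.logb 2 (3 / Real.goldenRatio) ∧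
        HolderWith C r (fun t : ℝ => f t 0)) ∧
      -- and `f₀` gives the asymptotics of the summatory function.
      (∀ ε : ℝ, 0 < ε → ∃ C : ℝ, ∀ x : ℝ, 1 ≤ x →
        |(∑ n ∈ Finset.range (⌊x⌋₊ + 1), (stern n : ℝ)) -
            (3 : ℝ) ^ (⌊Real.logb 2 x⌋ + 1) *
              f ((2 : ℝ) ^ (Int.fract (Real.logb 2 x) - 1)) 0|
          ≤ C * x ^ (Real.logb 2 Real.goldenRatio + ε)) := by
  obtain ⟨f, hf, hc, hb⟩ := exists_continuous_isSternDilationSolution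
  obtain ⟨M, hM⟩ := IsSternDilationSolution.exists_abs_le hb
  exact ⟨f, ⟨hf, hc, hb⟩, fun g hg hgb => hg.eq_of_isBounded hf hgb hb,
    hf.exists_holderWith_apply_zero hM, fun ε hε => hf.exists_abs_sum_stern_sub_le hM hε⟩
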